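/- Let $(X_i,Y_i,Z_i)_{i\ge 1}$ be an i.i.d. sequence of triples with the law of $(X,Y,Z)$, where $Y$ is real-valued and $X,Z$ take values in arbitrary measurable spaces. Let $\Theta$ be a compact metric space, $\mathcal T$ a separable topological space, and let $\mathcal G=\{g(\cdot;\theta):\theta\in\Theta\}$ and $\mathcal F=\{f(\cdot;\tau):\tau\in\mathcal T\}$ be families of measurable real-valued functions of $x$ and of $z$. Write $\psi(h;\theta)=\mathbb E[h(Z)(Y-g(X;\theta))]$ and $$U_{\tilde\theta}(\theta,\tau)=\frac1n\sum_{i=1}^n f(Z_i;\tau)(Y_i-g(X_i;\theta))-\frac1{4n}\sum_{i=1}^n f(Z_i;\tau)^2(Y_i-g(X_i;\tilde\theta))^2 .$$ Assume: 1. (Identification) $\theta_0$ is the unique $\theta\in\Theta$ with $\psi(h;\theta)=0$ for all $h\in\mathcal F$. 2. (Vanishing Rademacher complexities) As $n\to\infty$, $$\frac1{2^n}\sum_{\xi\in\{-1,+1\}^n}\mathbb E\sup_{\tau\in\mathcal T}\frac1n\sum_{i=1}^n\xi_i f(Z_i;\tau)\to0,\qquad \frac1{2^n}\sum_{\xi\in\{-1,+1\}^n}\mathbb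 E\sup_{\theta\in\Theta}\frac1n\sum_{i=1}^n\xi_i g(X_i;\theta)\to0 .$$ 3. (Absolutely star shaped) $\lambda h\in\mathcal F$ for every $h\in\mathcal F$ and every real $\lambda$ with $|\lambda|\le1$. 4. (Continuity) For all $x$ and $z$, $\theta\mapsto g(x;\theta)$ and $\tau\mapsto f(z;\tau)$ are continuous. 5. (Boundedness) $Y$, $\sup_{\theta\in\Theta}|g(X;\theta)|$ and $\sup_{\tau\in\mathcal T}|f(Z;\tau)|$ are bounded random variables. Let $\tilde\theta_n$ be a random sequence in $\Theta$ that has a limit in probability, and let $(\hat\theta_n,\hat\tau_n)$ be random sequences in $\Theta\times\mathcal T$ that form an approximate equilibrium, i.e. $$\sup_{\tau\in\mathcal T}U_{\tilde\theta_n}(\hat\theta_n,\tau)-o_p(1)\le U_{\tilde\theta_n}(\hat\theta_n,\hat\tau_n)\le\inf_{\theta\in\Theta}U_{\tilde\theta_n}(\theta,\hat\tau_n)+o_p(1).$$ Then $\hat\theta_n\to\theta_0$ in probability. -/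

import Mathlib

open MeasureTheory ProbabilityTheory Filter Topology

namespace DeepGMM

noncomputable section

/-- The critic class: the set of all functions `z ↦ f(z; τ)`, as `τ` ranges over the
parameter space. -/
def criticClass {𝒵 𝒯 : Type*} (f : 𝒵 → 𝒯 → ℝ) : Set (𝒵 → ℝ) :=
  Set.range fun (τ : 𝒯) (z : 𝒵) => f z τ

/-- The population moment `ψ(h; θ) = E[h(Z) (Y - g(X; θ))]`, where `P` is the law of the
triple `(X, Y, Z)`. -/
def moment {𝒳 𝒵 Θ : Type*} [MeasurableSpace 𝒳] [MeasurableSpace 𝒵]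
    (P : Measure (𝒳 × ℝ × 𝒵)) (g : 𝒳 → Θ → ℝ) (h : 𝒵 → ℝ) (θ : Θ) : ℝ :=
  ∫ w, h w.2.2 * (w.2.1 - g w.1 θ) ∂P

/-- Identification: `θ₀` is the unique parameter that satisfies all moment conditions given
by the critic class. -/
def Identified {𝒳 𝒵 Θ 𝒯 : Type*} [MeasurableSpace 𝒳] [MeasurableSpace 𝒵]
    (P : Measure (𝒳 × ℝ × 𝒵)) (g : 𝒳 → Θ → ℝ) (f : 𝒵 → 𝒯 → ℝ) (θ₀ : Θ) : Prop :=
  (∀ h ∈ criticClass f, moment P g h θ₀ = 0) ∧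
    ∀ θ : Θ, (∀ h ∈ criticClass f, moment P g h θ = 0) → θ = θ₀

/-- The `n`-th Rademacher complexity
`2⁻ⁿ ∑_{ξ ∈ {-1,+1}ⁿ} E sup_p (1/n) ∑_{i < n} ξ_i h(V_i; p)`
of a parametrized class of functions, evaluated at the random points `V_0, …, V_{n-1}`.
The group `ℤˣ` is `{-1, +1}`. -/
def rademacherComplexity {Ω 𝒱 S : Type*} [MeasurableSpace Ω] (μ : Measure Ω)
    (V : ℕ → Ω → 𝒱) (h : 𝒱 → S → ℝ) (n : ℕ) : ℝ :=
  (1 / 2 ^ n : ℝ) * ∑ ξ : Fin n → ℤˣ,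
    ∫ ω, ⨆ p : S, (1 / n : ℝ) * ∑ i : Fin n, ((ξ i : ℤ) : ℝ) * h (V i ω) p ∂μ

/-- A set of real functions is absolutely star shaped if it is stable under multiplication by
every scalar of absolute value at most one. -/
def AbsolutelyStarShaped {𝒵 : Type*} (F : Set (𝒵 → ℝ)) : Prop :=
  ∀ h ∈ F, ∀ c : ℝ, |c| ≤ 1 → (fun z => c * h z) ∈ F

/-- `Y`, `sup_θ |g(X; θ)|` and `sup_τ |f(Z; τ)|` are bounded random variables, where `P` is the
law of the triple `(X, Y, Z)`. -/
def BoundedModel {𝒳 𝒵 Θ 𝒯 : Type*} [MeasurableSpace 𝒳] [MeasurableSpace 𝒵]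
    (P : Measure (𝒳 × ℝ × 𝒵)) (g : 𝒳 → Θ → ℝ) (f : 𝒵 → 𝒯 → ℝ) : Prop :=
  ∃ B : ℝ, ∀ᵐ w ∂P, |w.2.1| ≤ B ∧ (∀ θ, |g w.1 θ| ≤ B) ∧ ∀ τ, |f w.2.2 τ| ≤ B

/-- The payoff
`U_{θ'}(θ, τ) = (1/n) ∑ f(Z_i; τ) (Y_i - g(X_i; θ)) - (1/(4n)) ∑ f(Z_i; τ)² (Y_i - g(X_i; θ'))²`
of the game with weighting parameter `θ'`, on the sample `(X_i, Y_i, Z_i)`, `i < n`, at the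
outcome `ω`. -/
def payoff {Ω 𝒳 𝒵 Θ 𝒯 : Type*} (X : ℕ → Ω → 𝒳) (Y : ℕ → Ω → ℝ) (Z : ℕ → Ω → 𝒵)
    (g : 𝒳 → Θ → ℝ) (f : 𝒵 → 𝒯 → ℝ) (n : ℕ) (ω : Ω) (θ' θ : Θ) (τ : 𝒯) : ℝ :=
  (1 / n : ℝ) * ∑ i ∈ Finset.range n, f (Z i ω) τ * (Y i ω - g (X i ω) θ)
    - (1 / (4 * n) : ℝ) *
      ∑ i ∈ Finset.range n, f (Z i ω) τ ^ 2 * (Y i ω - g (X i ω) θ') ^ 2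

/-- A sequence of real random variables is `o_p(1)`: it converges to zero in probability. -/
def IsLittleOpOne {Ω : Type*} [MeasurableSpace Ω] (μ : Measure Ω) (r : ℕ → Ω → ℝ) : Prop :=
  TendstoInMeasure μ r atTop fun _ => 0

/-- `(θhat, τhat)` is an approximate equilibrium of the games with (random) weighting
parameters `θtilde`: almost surely
`sup_τ U(θhat, τ) - o_p(1) ≤ U(θhat, τhat) ≤ inf_θ U(θ, τhat) + o_p(1)`. -/
def IsApproxEquilibrium {Ω 𝒳 𝒵 Θ 𝒯 : Type*} [MeasurableSpace Ω] (μ : Measure Ω)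
    (X : ℕ → Ω → 𝒳) (Y : ℕ → Ω → ℝ) (Z : ℕ → Ω → 𝒵) (g : 𝒳 → Θ → ℝ) (f : 𝒵 → 𝒯 → ℝ)
    (θtilde θhat : ℕ → Ω → Θ) (τhat : ℕ → Ω → 𝒯) : Prop :=
  ∃ r s : ℕ → Ω → ℝ, IsLittleOpOne μ r ∧ IsLittleOpOne μ s ∧ ∀ n, ∀ᵐ ω ∂μ,
    (⨆ τ, payoff X Y Z g f n ω (θtilde n ω) (θhat n ω) τ) - r n ω
        ≤ payoff X Y Z g f n ω (θtilde n ω) (θhat n ω) (τhat n ω) ∧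
      payoff X Y Z g f n ω (θtilde n ω) (θhat n ω) (τhat n ω)
        ≤ (⨅ θ, payoff X Y Z g f n ω (θtilde n ω) θ (τhat n ω)) + s n ω

end

end DeepGMM

/-!
The proof uses compactness to replace the uniform law of large numbers over pairs `(θ, τ)` by one
for each variable separately.

*Uniform laws.* Let `h` be a class with vanishing Rademacher complexity and let `F` be a class with
`|F w p - F w q| ≤ L * |h w p - h w q|`. Symmetrization (`integral_ciSup_sub_le`) and the
contraction principle (`sum_units_ciSup_le`) bound the expected one-sided uniform deviation of `F`
by `2 * L` times the complexity of `h` (`integral_ciSup_deviation_le`), and the deviation at a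
single index tends to zero in `L¹`, so that Markov's inequality gives uniform convergence in outer
probability (`tendsto_measure_exists_deviation`). This applies to the empirical moments as functions
of `τ` at `θ = θ₀`, where they are a bounded multiple of `f`, and as functions of `θ` for a fixed
`τ`, where they are an affine function of `g` with bounded coefficients.

*The game.* Fix `ε > 0`. By identification, the points at distance at least `ε` from `θ₀` each have
a critic with nonzero population moment; they form a compact set, so finitely many critics `T` see a
moment larger than some `c > 0` throughout it (`exists_finset_lt_abs_of_isCompact`). With high
probability the empirical moments are uniformly small in `τ` at `θ₀`, which makes the value of the
game at the equilibrium small: the minimizing player can choose `θ₀`, and the quadratic term only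
lowers the payoff. If `θhat` were at distance at least `ε` from `θ₀`, some critic in `T`,
multiplied by a small constant `±a`, would give the maximizing player a payoff of at least
`a * c / 4`, because the linear term of the payoff is of order `a` and the quadratic one of order
`a ^ 2` (`quarter_mul_le_of_equilibrium`). The quadratic term enters only through its sign and
its boundedness.
-/

namespace DeepGMM

/-! ### Contraction of Rademacher averages -/

lemma bddAbove_range_of_abs_le {S : Type*} {u : S → ℝ} {C : ℝ} (hu : ∀ p, |u p| ≤ C) :
    BddAbove (Set.range u) :=
  ⟨C, by rintro _ ⟨p, rfl⟩; exact (abs_le.mp (hu p)).2⟩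

lemma abs_ciSup_le {S : Type*} [Nonempty S] {u : S → ℝ} {C : ℝ} (hu : ∀ p, |u p| ≤ C) :
    |⨆ p, u p| ≤ C := by
  obtain ⟨p₀⟩ := ‹Nonempty S›
  have : Nonempty S := ⟨p₀⟩
  exact abs_le.mpr ⟨(abs_le.mp (hu p₀)).1.trans (le_ciSup (bddAbove_range_of_abs_le hu) p₀),
    ciSup_le fun p => (abs_le.mp (hu p)).2⟩

lemma ciSup_add_add_ciSup_sub_le {S : Type*} [Nonempty S] {v s t : S → ℝ}
    (hadd : BddAbove (Set.range fun p => v p + t p))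
    (hsub : BddAbove (Set.range fun p => v p - t p))
    (hst : ∀ p q, |s p - s q| ≤ |t p - t q|) :
    (⨆ p, v p + s p) + (⨆ p, v p - s p) ≤ (⨆ p, v p + t p) + ⨆ p, v p - t p := by
  rw [← le_sub_iff_add_le]
  refine ciSup_le fun p => ?_
  rw [le_sub_iff_add_le, add_comm, ← le_sub_iff_add_le]
  refine ciSup_le fun q => ?_
  have h1 := le_ciSup hadd p
  have h2 := le_ciSup hsub q
  have h3 := le_ciSup hadd q
  have h4 := le_ciSup hsub p
  have h5 := (le_abs_self _).trans (hst p q)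
  beta_reduce at h1 h2 h3 h4
  rcases abs_cases (t p - t q) with ⟨h, -⟩ | ⟨h, -⟩ <;> rw [h] at h5 <;> linarith

lemma abs_units_sum_le {n : ℕ} (ξ : Fin n → ℤˣ) {x : Fin n → ℝ} {C : ℝ} (hx : ∀ i, |x i| ≤ C) :
    |∑ i, ((ξ i : ℤ) : ℝ) * x i| ≤ n * C := by
  refine (Finset.abs_sum_le_sum_abs _ _).trans ?_
  refine (Finset.sum_le_card_nsmul _ _ C fun i _ => ?_).trans (by simp)
  rcases Int.units_eq_one_or (ξ i) with h | h <;> simpa [h] using hx i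

/-- The contraction principle for Rademacher averages: replacing increments by dominated
increments, coordinate by coordinate, does not increase the average over all signs. -/
theorem sum_units_ciSup_le {S : Type*} [Nonempty S] {n : ℕ} {C : ℝ} {u : S → ℝ}
    {s t : Fin n → S → ℝ} (hu : ∃ D, ∀ p, |u p| ≤ D) (hs : ∀ i p, |s i p| ≤ C)
    (ht : ∀ i p, |t i p| ≤ C) (hst : ∀ i p q, |s i p - s i q| ≤ |t i p - t i q|) :
    ∑ ξ : Fin n → ℤˣ, ⨆ p, (u p + ∑ i, ((ξ i : ℤ) : ℝ) * s i p) ≤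
      ∑ ξ : Fin n → ℤˣ, ⨆ p, (u p + ∑ i, ((ξ i : ℤ) : ℝ) * t i p) := by
  induction n generalizing u with
  | zero => simp
  | succ n ih =>
    obtain ⟨D, hD⟩ := hu
    have split : ∀ r : Fin (n + 1) → S → ℝ,
        ∑ ξ : Fin (n + 1) → ℤˣ, ⨆ p, (u p + ∑ i, ((ξ i : ℤ) : ℝ) * r i p) =
        (∑ ξ : Fin n → ℤˣ, ⨆ p, (u p + r 0 p + ∑ i, ((ξ i : ℤ) : ℝ) * r i.succ p)) +
        ∑ ξ : Fin n → ℤˣ, ⨆ p, (u p - r 0 p + ∑ i, ((ξ i : ℤ) : ℝ) * r i.succ p) := by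
      intro r
      rw [← (Fin.consEquiv fun _ => ℤˣ).sum_comp, Fintype.sum_prod_type]
      have : (Finset.univ : Finset ℤˣ) = {1, -1} := by decide
      rw [this, Finset.sum_pair (by decide)]
      simp only [Fin.consEquiv_apply, Fin.sum_univ_succ, Fin.cons_zero, Fin.cons_succ, add_assoc,
        Units.val_one, Units.val_neg, Int.cast_one, Int.cast_neg, one_mul, neg_mul, sub_eq_add_neg]
    have hs0 : ∀ c : ℝ, |c| = 1 → ∃ D', ∀ p, |u p + c * s 0 p| ≤ D' := fun c hc =>
      ⟨D + C, fun p => (abs_add_le _ _).trans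
        (add_le_add (hD p) (by rw [abs_mul, hc, one_mul]; exact hs 0 p))⟩
    have h1 := ih (u := fun p => u p + s 0 p) (s := fun i => s i.succ) (t := fun i => t i.succ)
      (by simpa using hs0 1 (by simp)) (fun i => hs _) (fun i => ht _) (fun i => hst _)
    have h2 := ih (u := fun p => u p - s 0 p) (s := fun i => s i.succ) (t := fun i => t i.succ)
      (by simpa [sub_eq_add_neg] using hs0 (-1) (by simp)) (fun i => hs _) (fun i => ht _)
      (fun i => hst _)
    rw [split s, split t]
    refine (add_le_add h1 h2).trans ?_
    rw [← Finset.sum_add_distrib, ← Finset.sum_add_distrib]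
    refine Finset.sum_le_sum fun ξ _ => ?_
    have hb : ∀ c : ℝ, |c| = 1 → ∀ p,
        |u p + ∑ i : Fin n, ((ξ i : ℤ) : ℝ) * t i.succ p + c * t 0 p| ≤ D + n * C + C :=
      fun c hc p => (abs_add_le _ _).trans (add_le_add ((abs_add_le _ _).trans (add_le_add (hD p)
        (abs_units_sum_le ξ fun i => ht _ p))) (by rw [abs_mul, hc, one_mul]; exact ht 0 p))
    have key := ciSup_add_add_ciSup_sub_le
      (v := fun p => u p + ∑ i : Fin n, ((ξ i : ℤ) : ℝ) * t i.succ p) (s := s 0) (t := t 0)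
      (bddAbove_range_of_abs_le (by simpa using hb 1 (by simp)))
      (bddAbove_range_of_abs_le (by simpa [sub_eq_add_neg] using hb (-1) (by simp))) (hst 0)
    simpa only [add_right_comm, sub_eq_add_neg] using key

/-! ### Symmetrization -/

section Symmetrization

variable {𝒲 : Type*} [MeasurableSpace 𝒲]

/-- Exchange of the `i`-th points of a sample and of a second sample, for all `i` with
`ξ i ≠ 1`. -/
def signSwap {n : ℕ} (ξ : Fin n → ℤˣ) (w : (Fin n → 𝒲) × (Fin n → 𝒲)) :
    (Fin n → 𝒲) × (Fin n → 𝒲) :=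
  (fun i => if ξ i = 1 then w.1 i else w.2 i, fun i => if ξ i = 1 then w.2 i else w.1 i)

lemma measurePreserving_signSwap (P : Measure 𝒲) [IsProbabilityMeasure P] {n : ℕ}
    (ξ : Fin n → ℤˣ) :
    MeasurePreserving (signSwap ξ)
      ((Measure.pi fun _ : Fin n => P).prod (Measure.pi fun _ : Fin n => P))
      ((Measure.pi fun _ : Fin n => P).prod (Measure.pi fun _ : Fin n => P)) := by
  have hm : Measurable (signSwap (𝒲 := 𝒲) ξ) := by
    refine Measurable.prodMk (measurable_pi_lambda _ fun i => ?_)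
      (measurable_pi_lambda _ fun i => ?_) <;> split_ifs <;> fun_prop
  refine ⟨hm, ?_⟩
  have hgen : MeasurableSpace.generateFrom
      (Set.pi Set.univ '' Set.pi Set.univ fun _ : Fin n => {s : Set 𝒲 | MeasurableSet s}) =
      MeasurableSpace.pi := generateFrom_pi
  have hspan : (Measure.pi fun _ : Fin n => P).FiniteSpanningSetsIn
      (Set.pi Set.univ '' Set.pi Set.univ fun _ : Fin n => {s : Set 𝒲 | MeasurableSet s}) :=
    { set := fun _ => Set.univ
      set_mem := fun _ => ⟨fun _ => Set.univ, fun _ _ => MeasurableSet.univ, Set.pi_univ _⟩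
      finite := fun _ => measure_lt_top _ _
      spanning := Set.iUnion_const _ }
  refine (Measure.prod_eq_generateFrom hgen hgen isPiSystem_pi isPiSystem_pi hspan hspan ?_).symm
  rintro _ ⟨s, hs, rfl⟩ _ ⟨t, ht, rfl⟩
  have hs' : ∀ i, MeasurableSet (s i) := fun i => hs i trivial
  have ht' : ∀ i, MeasurableSet (t i) := fun i => ht i trivial
  rw [Measure.map_apply hm ((MeasurableSet.univ_pi hs').prod (MeasurableSet.univ_pi ht'))]
  have hpre : signSwap ξ ⁻¹' (Set.univ.pi s ×ˢ Set.univ.pi t) =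
      (Set.univ.pi fun i => if ξ i = 1 then s i else t i) ×ˢ
        (Set.univ.pi fun i => if ξ i = 1 then t i else s i) := by
    ext w
    simp only [signSwap, Set.mem_preimage, Set.mem_prod, Set.mem_pi, Set.mem_univ, true_imp_iff,
      ← forall_and]
    refine forall_congr' fun i => ?_
    split_ifs <;> tauto
  rw [hpre, Measure.prod_prod]
  simp only [Measure.pi_pi, ← Finset.prod_mul_distrib]
  refine Finset.prod_congr rfl fun i _ => ?_
  split_ifs
  · rfl
  · exact mul_comm _ _

lemma integrable_ciSup {β S : Type*} [MeasurableSpace β] {ν : Measure β} [IsFiniteMeasure ν]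
    [Countable S] [Nonempty S] {G : β → S → ℝ} (hG : ∀ p, Measurable fun b => G b p) {C : ℝ}
    (hC : ∀ b p, |G b p| ≤ C) : Integrable (fun b => ⨆ p, G b p) ν :=
  .of_bound (Measurable.iSup hG).aestronglyMeasurable C (ae_of_all _ fun b => abs_ciSup_le (hC b))

lemma abs_sum_fin_le {n : ℕ} {x : Fin n → ℝ} {C : ℝ} (hx : ∀ i, |x i| ≤ C) :
    |∑ i, x i| ≤ n * C := by
  simpa using abs_units_sum_le 1 hx

variable {S : Type*} [Countable S] [Nonempty S] {F : 𝒲 → S → ℝ} {C : ℝ}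

/-- Symmetrization: centred empirical sums are dominated, on average, by twice the Rademacher
averages. The means are replaced by a second, independent sample, and exchanging points of the
two samples introduces arbitrary signs. -/
theorem integral_ciSup_sub_le (P : Measure 𝒲) [IsProbabilityMeasure P] (n : ℕ)
    (hF : ∀ p, Measurable fun w => F w p) (hC : ∀ w p, |F w p| ≤ C) :
    2 ^ n * ∫ w, ⨆ p, ∑ i, (F (w i) p - ∫ v, F v p ∂P) ∂(Measure.pi fun _ : Fin n => P) ≤
      2 * ∑ ξ : Fin n → ℤˣ,
        ∫ w, ⨆ p, ∑ i, ((ξ i : ℤ) : ℝ) * F (w i) p ∂(Measure.pi fun _ : Fin n => P) := by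
  set Q : Measure (Fin n → 𝒲) := Measure.pi fun _ : Fin n => P with hQ
  have hFi : ∀ p (i : Fin n), Measurable fun w : Fin n → 𝒲 => F (w i) p := fun p i =>
    (hF p).comp (measurable_pi_apply i)
  have hFint : ∀ p (i : Fin n), Integrable (fun w : Fin n → 𝒲 => F (w i) p) Q := fun p i =>
    .of_bound (hFi p i).aestronglyMeasurable C (ae_of_all _ fun w => hC _ _)
  have hmean : ∀ p, |∫ v, F v p ∂P| ≤ C := fun p => by
    simpa using norm_integral_le_of_norm_le_const (μ := P) (f := fun v => F v p) (C := C)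
      (ae_of_all _ fun v => hC v p)
  have hFi1 : ∀ p (i : Fin n),
      Measurable fun z : (Fin n → 𝒲) × (Fin n → 𝒲) => F (z.1 i) p := fun p i =>
    (hFi p i).comp measurable_fst
  have hFi2 : ∀ p (i : Fin n),
      Measurable fun z : (Fin n → 𝒲) × (Fin n → 𝒲) => F (z.2 i) p := fun p i =>
    (hFi p i).comp measurable_snd
  have hdiff : ∀ v w p, |F v p - F w p| ≤ 2 * C := fun v w p =>
    (abs_sub _ _).trans (by linarith [hC v p, hC w p])
  have hGmeas : ∀ p, Measurable fun z : (Fin n → 𝒲) × (Fin n → 𝒲) =>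
      ∑ i, (F (z.1 i) p - F (z.2 i) p) := fun p =>
    Finset.measurable_fun_sum _ fun i _ => (hFi1 p i).sub (hFi2 p i)
  have hGint : Integrable (fun z : (Fin n → 𝒲) × (Fin n → 𝒲) =>
      ⨆ p, ∑ i, (F (z.1 i) p - F (z.2 i) p)) (Q.prod Q) :=
    integrable_ciSup hGmeas fun z p => abs_sum_fin_le fun i => hdiff _ _ _
  have hRint : ∀ ξ : Fin n → ℤˣ,
      Integrable (fun w => ⨆ p, ∑ i, ((ξ i : ℤ) : ℝ) * F (w i) p) Q := fun ξ =>
    integrable_ciSup (fun p => Finset.measurable_fun_sum _ fun i _ => (hFi p i).const_mul _)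
      fun w p => abs_units_sum_le ξ fun i => hC _ _
  -- The means are averages over the second sample.
  have ghost : ∫ w, ⨆ p, ∑ i, (F (w i) p - ∫ v, F v p ∂P) ∂Q ≤
      ∫ z, ⨆ p, ∑ i, (F (z.1 i) p - F (z.2 i) p) ∂(Q.prod Q) := by
    rw [integral_prod _ hGint]
    refine integral_mono (integrable_ciSup (fun p => Finset.measurable_fun_sum _ fun i _ =>
      (hFi p i).sub_const _) fun w p => abs_sum_fin_le (C := 2 * C) fun i =>
        (abs_sub _ _).trans (by linarith [hC (w i) p, hmean p])) hGint.integral_prod_left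
      fun w => ciSup_le fun p => ?_
    have hint : ∀ i, Integrable (fun w' : Fin n → 𝒲 => F (w i) p - F (w' i) p) Q := fun i =>
      (integrable_const _).sub (hFint p i)
    have hsum : ∑ i, (F (w i) p - ∫ v, F v p ∂P) =
        ∫ w', ∑ i, (F (w i) p - F (w' i) p) ∂Q := by
      rw [integral_finsetSum _ fun i _ => hint i]
      refine Finset.sum_congr rfl fun i _ => ?_
      rw [integral_sub (integrable_const _) (hFint p i), integral_const, probReal_univ, one_smul,
        ← (measurePreserving_eval (fun _ : Fin n => P) i).map_eq, integral_map
          (measurable_pi_apply i).aemeasurable (hF p).aestronglyMeasurable]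
    rw [hsum]
    refine integral_mono (integrable_finsetSum _ fun i _ => hint i)
      (integrable_ciSup (fun p => Finset.measurable_fun_sum _ fun i _ => (hFi p i).const_sub (F (w i) p))
        fun w' p => abs_sum_fin_le fun i => hdiff _ _ _) fun w' => ?_
    exact le_ciSup (f := fun p => ∑ i, (F (w i) p - F (w' i) p))
      (bddAbove_range_of_abs_le fun p => abs_sum_fin_le fun i => hdiff _ _ _) p
  have signs : ∀ ξ : Fin n → ℤˣ, ∫ z, ⨆ p, ∑ i, (F (z.1 i) p - F (z.2 i) p) ∂(Q.prod Q) ≤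
      (∫ w, ⨆ p, ∑ i, ((ξ i : ℤ) : ℝ) * F (w i) p ∂Q) +
        ∫ w, ⨆ p, ∑ i, (((-ξ) i : ℤ) : ℝ) * F (w i) p ∂Q := by
    intro ξ
    have hT := measurePreserving_signSwap P ξ
    rw [← hQ] at hT
    rw [← hT.map_eq, integral_map hT.measurable.aemeasurable
      (Measurable.iSup hGmeas).aestronglyMeasurable]
    have h1 := (hRint ξ).comp_fst Q
    have h2 := (hRint (-ξ)).comp_snd Q
    have e1 := integral_fun_fst (μ := Q) (ν := Q)
      (fun w => ⨆ p, ∑ i, ((ξ i : ℤ) : ℝ) * F (w i) p)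
    have e2 := integral_fun_snd (μ := Q) (ν := Q)
      (fun w => ⨆ p, ∑ i, (((-ξ) i : ℤ) : ℝ) * F (w i) p)
    rw [probReal_univ, one_smul] at e1 e2
    rw [← e1, ← e2, ← integral_add h1 h2]
    refine integral_mono ((hT.integrable_comp hGint.aestronglyMeasurable).2 hGint) (h1.add h2)
      fun z => ciSup_le fun p => ?_
    refine le_trans (le_of_eq ?_) (add_le_add
      (le_ciSup (f := fun p => ∑ i, ((ξ i : ℤ) : ℝ) * F (z.1 i) p)
        (bddAbove_range_of_abs_le fun p => abs_units_sum_le ξ fun i => hC _ _) p)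
      (le_ciSup (f := fun p => ∑ i, (((-ξ) i : ℤ) : ℝ) * F (z.2 i) p)
        (bddAbove_range_of_abs_le fun p => abs_units_sum_le (-ξ) fun i => hC _ _) p))
    dsimp only
    rw [← Finset.sum_add_distrib]
    refine Finset.sum_congr rfl fun i _ => ?_
    rcases Int.units_eq_one_or (ξ i) with h | h <;> simp [signSwap, h] <;> ring
  have hcard : (Finset.univ : Finset (Fin n → ℤˣ)).card = 2 ^ n := by simp
  calc _ ≤ ∑ _ξ : Fin n → ℤˣ, ∫ z, ⨆ p, ∑ i, (F (z.1 i) p - F (z.2 i) p) ∂(Q.prod Q) := by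
        rw [Finset.sum_const, hcard, nsmul_eq_mul]; push_cast; gcongr
    _ ≤ _ := Finset.sum_le_sum fun ξ _ => signs ξ
    _ = _ := by
        rw [Finset.sum_add_distrib, two_mul]
        congr 1
        exact Equiv.sum_comp (Equiv.neg (Fin n → ℤˣ)) fun ξ : Fin n → ℤˣ =>
          ∫ w, ⨆ p, ∑ i, ((ξ i : ℤ) : ℝ) * F (w i) p ∂Q

end Symmetrization

/-! ### Uniform laws of large numbers -/

section UniformLaw

variable {Ω 𝒲 : Type*} [MeasurableSpace Ω] [MeasurableSpace 𝒲] {μ : Measure Ω}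
  [IsProbabilityMeasure μ] {P : Measure 𝒲} {W : ℕ → Ω → 𝒲}

lemma integral_sample (hW : ∀ i, Measurable (W i)) (hlaw : ∀ i, μ.map (W i) = P)
    (hindep : iIndepFun W μ) {n : ℕ} {G : (Fin n → 𝒲) → ℝ} (hG : Measurable G) :
    ∫ ω, G (fun i => W i ω) ∂μ = ∫ w, G w ∂(Measure.pi fun _ : Fin n => P) := by
  have h := (iIndepFun_iff_map_fun_eq_pi_map (f := fun i : Fin n => W i)
    fun i => (hW i).aemeasurable).1 (hindep.precomp Fin.val_injective)
  simp only [hlaw] at h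
  rw [← h, integral_map (measurable_pi_lambda _ fun i : Fin n => hW i).aemeasurable
    hG.aestronglyMeasurable]

/-- The expected uniform deviation of `F` is controlled by the Rademacher complexity of any
class `h` whose increments dominate those of `F`. -/
theorem integral_ciSup_deviation_le {S : Type*} [Countable S] [Nonempty S]
    (hW : ∀ i, Measurable (W i)) (hlaw : ∀ i, μ.map (W i) = P) (hindep : iIndepFun W μ)
    {F h : 𝒲 → S → ℝ} {C L : ℝ} (hF : ∀ p, Measurable fun w => F w p)
    (hh : ∀ p, Measurable fun w => h w p) (hFC : ∀ w p, |F w p| ≤ C) (hhC : ∀ w p, |h w p| ≤ C)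
    (hL : 0 ≤ L) (hFh : ∀ w p q, |F w p - F w q| ≤ L * |h w p - h w q|) (n : ℕ) :
    ∫ ω, ⨆ p, (1 / n : ℝ) * ∑ i : Fin n, (F (W i ω) p - ∫ v, F v p ∂P) ∂μ ≤
      2 * L * rademacherComplexity μ W h n := by
  have hP : IsProbabilityMeasure P := hlaw 0 ▸ Measure.isProbabilityMeasure_map (hW 0).aemeasurable
  have hn : (0 : ℝ) ≤ 1 / n := by positivity
  have hmul : ∀ ξ : Fin n → ℤˣ, ∀ r : 𝒲 → S → ℝ, (∀ p, Measurable fun w => r w p) →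
      Measurable fun w : Fin n → 𝒲 => ⨆ p, ∑ i, ((ξ i : ℤ) : ℝ) * r (w i) p := fun ξ r hr =>
    Measurable.iSup fun p => Finset.measurable_fun_sum _ fun i _ =>
      ((hr p).comp (measurable_pi_apply i)).const_mul _
  have hcent : Measurable fun w : Fin n → 𝒲 => ⨆ p, ∑ i, (F (w i) p - ∫ v, F v p ∂P) :=
    Measurable.iSup fun p => Finset.measurable_fun_sum _ fun i _ =>
      ((hF p).comp (measurable_pi_apply i)).sub_const _
  have hrad : rademacherComplexity μ W h n = (1 / 2 ^ n : ℝ) * ((1 / n : ℝ) *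
      ∑ ξ : Fin n → ℤˣ, ∫ w, ⨆ p, ∑ i, ((ξ i : ℤ) : ℝ) * h (w i) p
        ∂(Measure.pi fun _ : Fin n => P)) := by
    rw [rademacherComplexity, Finset.mul_sum Finset.univ _ (1 / n : ℝ)]
    congr 1
    refine Finset.sum_congr rfl fun ξ _ => ?_
    simp only [← Real.mul_iSup_of_nonneg hn, integral_const_mul]
    rw [integral_sample hW hlaw hindep (hmul ξ h hh)]
  have hcontr : ∑ ξ : Fin n → ℤˣ, ∫ w, ⨆ p, ∑ i, ((ξ i : ℤ) : ℝ) * F (w i) p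
        ∂(Measure.pi fun _ : Fin n => P) ≤
      L * ∑ ξ : Fin n → ℤˣ, ∫ w, ⨆ p, ∑ i, ((ξ i : ℤ) : ℝ) * h (w i) p
        ∂(Measure.pi fun _ : Fin n => P) := by
    have hi : ∀ ξ : Fin n → ℤˣ, ∀ r : 𝒲 → S → ℝ, (∀ p, Measurable fun w => r w p) →
        (∀ w p, |r w p| ≤ C) → Integrable (fun w : Fin n → 𝒲 =>
          ⨆ p, ∑ i, ((ξ i : ℤ) : ℝ) * r (w i) p) (Measure.pi fun _ : Fin n => P) :=
      fun ξ r hr hrC => .of_bound (hmul ξ r hr).aestronglyMeasurable (n * C)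
        (ae_of_all _ fun w => abs_ciSup_le fun p => abs_units_sum_le ξ fun i => hrC _ _)
    rw [← integral_finsetSum _ fun ξ _ => hi ξ F hF hFC,
      ← integral_finsetSum _ fun ξ _ => hi ξ h hh hhC, ← integral_const_mul]
    refine integral_mono (integrable_finsetSum _ fun ξ _ => hi ξ F hF hFC)
      ((integrable_finsetSum _ fun ξ _ => hi ξ h hh hhC).const_mul L) fun w => ?_
    have key := sum_units_ciSup_le (C := max C (L * C)) (u := fun _ : S => (0 : ℝ))
      (s := fun (i : Fin n) p => F (w i) p) (t := fun (i : Fin n) p => L * h (w i) p)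
      ⟨0, by simp⟩ (fun i p => (hFC _ _).trans (le_max_left _ _))
      (fun i p => by
        rw [abs_mul, abs_of_nonneg hL]
        exact (mul_le_mul_of_nonneg_left (hhC _ _) hL).trans (le_max_right _ _))
      (fun i p q => by
        rw [← mul_sub, abs_mul, abs_of_nonneg hL]
        exact hFh _ p q)
    simp only [zero_add, mul_left_comm _ L, ← Finset.mul_sum, ← Real.mul_iSup_of_nonneg hL] at key
    exact key
  have hsym := integral_ciSup_sub_le P n hF hFC
  simp only [← Real.mul_iSup_of_nonneg hn, integral_const_mul]
  rw [integral_sample hW hlaw hindep hcent, hrad]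
  have h2 : (0 : ℝ) < 2 ^ n := by positivity
  have h3 := hsym.trans (mul_le_mul_of_nonneg_left hcontr two_pos.le)
  rw [mul_comm, ← le_div_iff₀ h2] at h3
  refine (mul_le_mul_of_nonneg_left h3 hn).trans (le_of_eq ?_)
  ring

/-- One half of the uniform law of large numbers, for a countable index set and classes that are
bounded everywhere. -/
lemma tendsto_measure_le_ciSup_deviation {S : Type*} [Countable S] [Nonempty S]
    (hW : ∀ i, Measurable (W i)) (hlaw : ∀ i, μ.map (W i) = P) (hindep : iIndepFun W μ)
    {F h : 𝒲 → S → ℝ} {C L : ℝ} (hF : ∀ p, Measurable fun w => F w p)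
    (hh : ∀ p, Measurable fun w => h w p) (hFC : ∀ w p, |F w p| ≤ C) (hhC : ∀ w p, |h w p| ≤ C)
    (hL : 0 ≤ L) (hFh : ∀ w p q, |F w p - F w q| ≤ L * |h w p - h w q|)
    (hrad : Tendsto (rademacherComplexity μ W h) atTop (𝓝 0)) {δ : ℝ} (hδ : 0 < δ) :
    Tendsto (fun n : ℕ => μ {ω | δ ≤ ⨆ p,
      (1 / n : ℝ) * ∑ i : Fin n, (F (W i ω) p - ∫ v, F v p ∂P)}) atTop (𝓝 0) := by
  have hP : IsProbabilityMeasure P := hlaw 0 ▸ Measure.isProbabilityMeasure_map (hW 0).aemeasurable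
  obtain ⟨p₀⟩ := id ‹Nonempty S›
  have hmean : ∀ p, |∫ v, F v p ∂P| ≤ C := fun p => by
    simpa using norm_integral_le_of_norm_le_const (μ := P) (f := fun v => F v p) (C := C)
      (ae_of_all _ fun v => hFC v p)
  set A : ℕ → Ω → S → ℝ := fun n ω p =>
    (1 / n : ℝ) * ∑ i : Fin n, (F (W i ω) p - ∫ v, F v p ∂P) with hA
  have hAmeas : ∀ n p, Measurable fun ω => A n ω p := fun n p => by
    have hi : ∀ i : Fin n, Measurable fun ω => F (W i ω) p - ∫ v, F v p ∂P := fun i =>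
      ((hF p).comp (hW i)).sub_const _
    exact (Finset.measurable_fun_sum _ fun i _ => hi i).const_mul _
  have hAC : ∀ n ω p, |A n ω p| ≤ (1 / n : ℝ) * (n * (2 * C)) := fun n ω p => by
    rw [hA, abs_mul, abs_of_nonneg (by positivity : (0 : ℝ) ≤ 1 / n)]
    exact mul_le_mul_of_nonneg_left (abs_sum_fin_le fun i =>
      (abs_sub _ _).trans (by linarith [hFC (W i ω) p, hmean p])) (by positivity)
  have hAint : ∀ n p, Integrable (fun ω => A n ω p) μ := fun n p =>
    .of_bound (hAmeas n p).aestronglyMeasurable _ (ae_of_all _ fun ω => hAC n ω p)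
  have hSint : ∀ n, Integrable (fun ω => ⨆ p, A n ω p) μ := fun n =>
    integrable_ciSup (hAmeas n) (hAC n)
  have hlln : Tendsto (fun n => ∫ ω, |A n ω p₀| ∂μ) atTop (𝓝 0) := by
    have hmem : MemLp (fun ω => F (W 0 ω) p₀) 1 μ :=
      .of_bound ((hF p₀).comp (hW 0)).aestronglyMeasurable C (ae_of_all _ fun ω => hFC _ _)
    have h0 := strong_law_Lp le_rfl ENNReal.one_ne_top (fun i ω => F (W i ω) p₀) hmem
      (fun i j hij => (hindep.indepFun hij).comp (hF p₀) (hF p₀))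
      (fun i => (IdentDistrib.mk (hW i).aemeasurable (hW 0).aemeasurable
        ((hlaw i).trans (hlaw 0).symm)).comp (hF p₀))
    have hE : ∫ ω, F (W 0 ω) p₀ ∂μ = ∫ v, F v p₀ ∂P := by
      rw [← hlaw 0, integral_map (hW 0).aemeasurable (hF p₀).aestronglyMeasurable]
    have h1 := (ENNReal.tendsto_toReal ENNReal.zero_ne_top).comp h0
    rw [ENNReal.toReal_zero] at h1
    refine h1.congr' ((eventually_ne_atTop 0).mono fun n hn => ?_)
    have hfun : (fun ω => (n : ℝ)⁻¹ • (∑ i ∈ Finset.range n, F (W i ω) p₀) -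
        ∫ ω, F (W 0 ω) p₀ ∂μ) = fun ω => A n ω p₀ := by
      funext ω
      have hn' : (n : ℝ) ≠ 0 := Nat.cast_ne_zero.2 hn
      rw [hA, hE]
      dsimp only
      rw [Finset.sum_sub_distrib, ← Fin.sum_univ_eq_sum_range (fun i => F (W i ω) p₀), smul_eq_mul]
      simp only [Finset.sum_const, Finset.card_univ, Fintype.card_fin, nsmul_eq_mul]
      field_simp
    rw [Function.comp_apply, hfun, eLpNorm_one_eq_lintegral_enorm,
      ← integral_norm_eq_lintegral_enorm (hAmeas n p₀).aestronglyMeasurable]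
    rfl
  have hub : Tendsto (fun n => (2 * L * rademacherComplexity μ W h n + ∫ ω, |A n ω p₀| ∂μ) / δ)
      atTop (𝓝 0) := by
    simpa using ((hrad.const_mul (2 * L)).add hlln).div_const δ
  have hreal : Tendsto (fun n => μ.real {ω | δ ≤ ⨆ p, A n ω p}) atTop (𝓝 0) := by
    refine squeeze_zero (fun n => measureReal_nonneg) (fun n => ?_) hub
    -- Adding `|A n ω p₀|` makes the supremum nonnegative, as Markov's inequality requires.
    have hint : Integrable (fun ω => (⨆ p, A n ω p) + |A n ω p₀|) μ :=
      (hSint n).add (hAint n p₀).abs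
    have hnn : ∀ ω, 0 ≤ (⨆ p, A n ω p) + |A n ω p₀| := fun ω => by
      have h1 := le_ciSup (bddAbove_range_of_abs_le (hAC n ω)) p₀
      have h2 := neg_abs_le (A n ω p₀)
      linarith
    have hmark := mul_meas_ge_le_integral_of_nonneg (ae_of_all _ hnn) hint δ
    rw [integral_add (hSint n) (hAint n p₀).abs] at hmark
    have hexp := integral_ciSup_deviation_le hW hlaw hindep hF hh hFC hhC hL hFh n
    have hsub : μ.real {ω | δ ≤ ⨆ p, A n ω p} ≤
        μ.real {ω | δ ≤ (⨆ p, A n ω p) + |A n ω p₀|} :=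
      measureReal_mono fun ω (hω : δ ≤ _) => hω.trans (le_add_of_nonneg_right (abs_nonneg _))
    rw [le_div_iff₀ hδ, mul_comm]
    exact (mul_le_mul_of_nonneg_left hsub hδ.le).trans (hmark.trans (by gcongr))
  exact (ENNReal.tendsto_toReal_zero_iff fun n => measure_ne_top _ _).1 hreal

omit [IsProbabilityMeasure μ] in
lemma rademacherComplexity_dense {𝒱 S : Type*} [TopologicalSpace S] (V : ℕ → Ω → 𝒱)
    {h : 𝒱 → S → ℝ} (hh : ∀ v, Continuous (h v)) {D : Set S} (hD : Dense D) (n : ℕ) :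
    rademacherComplexity μ V (fun v (p : D) => h v p) n = rademacherComplexity μ V h n := by
  unfold rademacherComplexity
  congr 1
  refine Finset.sum_congr rfl fun ξ _ => integral_congr_ae (ae_of_all _ fun ω => ?_)
  exact hD.ciSup' (f := fun p => (1 / n : ℝ) * ∑ i : Fin n, ((ξ i : ℤ) : ℝ) * h (V i ω) p)
    (by fun_prop)

/-- One half of the uniform law of large numbers for separable index spaces. Continuity in the
index reduces suprema to a countable dense set, and cutting `F` and `h` off on a null set makes
the almost sure bounds hold everywhere. -/
lemma tendsto_measure_exists_le_deviation {S : Type*} [TopologicalSpace S]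
    [TopologicalSpace.SeparableSpace S] [Nonempty S]
    (hW : ∀ i, Measurable (W i)) (hlaw : ∀ i, μ.map (W i) = P) (hindep : iIndepFun W μ)
    {F h : 𝒲 → S → ℝ} {C L : ℝ} (hF : ∀ p, Measurable fun w => F w p)
    (hh : ∀ p, Measurable fun w => h w p) (hFcont : ∀ w, Continuous (F w))
    (hhcont : ∀ w, Continuous (h w)) (hmcont : Continuous fun p => ∫ v, F v p ∂P) (hL : 0 ≤ L)
    (hFC : ∀ᵐ w ∂P, ∀ p, |F w p| ≤ C) (hhC : ∀ᵐ w ∂P, ∀ p, |h w p| ≤ C)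
    (hFh : ∀ᵐ w ∂P, ∀ p q, |F w p - F w q| ≤ L * |h w p - h w q|)
    (hrad : Tendsto (rademacherComplexity μ W h) atTop (𝓝 0)) {δ : ℝ} (hδ : 0 < δ) :
    Tendsto (fun n : ℕ => μ {ω | ∃ p, δ ≤
      (1 / n : ℝ) * ∑ i ∈ Finset.range n, F (W i ω) p - ∫ v, F v p ∂P}) atTop (𝓝 0) := by
  have hP : IsProbabilityMeasure P := hlaw 0 ▸ Measure.isProbabilityMeasure_map (hW 0).aemeasurable
  obtain ⟨D, hDc, hD⟩ := TopologicalSpace.exists_countable_dense S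
  have : Countable D := hDc.to_subtype
  have : Nonempty D := hD.nonempty.to_subtype
  obtain ⟨N, hsub, hN, hN0⟩ := exists_measurable_superset_of_null
    (ae_iff.1 (hFC.and (hhC.and hFh)))
  have hgood : ∀ w ∉ N, (∀ p, |F w p| ≤ C) ∧ (∀ p, |h w p| ≤ C) ∧
      ∀ p q, |F w p - F w q| ≤ L * |h w p - h w q| := fun w hw => by
    by_contra hcon
    exact hw (hsub hcon)
  have hNae : ∀ᵐ w ∂P, w ∉ N := measure_eq_zero_iff_ae_notMem.1 hN0
  have hC0 : 0 ≤ C := by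
    obtain ⟨w, hw⟩ := hFC.exists
    exact (abs_nonneg _).trans (hw (Classical.arbitrary S))
  have hWN : ∀ᵐ ω ∂μ, ∀ i, W i ω ∉ N := ae_all_iff.2 fun i =>
    ae_of_ae_map (hW i).aemeasurable (by rwa [hlaw i])
  set F' : 𝒲 → D → ℝ := fun w p => Nᶜ.indicator (fun v => F v p) w with hF'
  set h' : 𝒲 → D → ℝ := fun w p => Nᶜ.indicator (fun v => h v p) w with hh'
  have eF : ∀ w ∉ N, ∀ p : D, F' w p = F w p := fun w hw p => Set.indicator_of_mem hw _
  have eh : ∀ w ∉ N, ∀ p : D, h' w p = h w p := fun w hw p => Set.indicator_of_mem hw _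
  have zF : ∀ w ∈ N, ∀ p : D, F' w p = 0 := fun w hw p => Set.indicator_of_notMem (by simpa) _
  have zh : ∀ w ∈ N, ∀ p : D, h' w p = 0 := fun w hw p => Set.indicator_of_notMem (by simpa) _
  have hrad' : Tendsto (rademacherComplexity μ W h') atTop (𝓝 0) := by
    refine hrad.congr fun n => ?_
    rw [← rademacherComplexity_dense W hhcont hD]
    unfold rademacherComplexity
    congr 1
    refine Finset.sum_congr rfl fun ξ _ => integral_congr_ae (hWN.mono fun ω hω => ?_)
    simp only [eh _ (hω _)]
  have hmean : ∀ p : D, ∫ v, F' v p ∂P = ∫ v, F v p ∂P := fun p =>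
    integral_congr_ae (hNae.mono fun w hw => eF w hw p)
  have hmC : ∀ p, |∫ v, F v p ∂P| ≤ C := fun p => by
    simpa using norm_integral_le_of_norm_le_const (μ := P) (f := fun v => F v p) (C := C)
      (hFC.mono fun w hw => hw p)
  have key := tendsto_measure_le_ciSup_deviation (C := C) (L := L) hW hlaw hindep
    (F := F') (h := h') (fun p => (hF p).indicator hN.compl) (fun p => (hh p).indicator hN.compl)
    (fun w p => by
      by_cases hw : w ∈ N
      · rwa [zF w hw, abs_zero]
      · rw [eF w hw]; exact (hgood w hw).1 p)
    (fun w p => by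
      by_cases hw : w ∈ N
      · rwa [zh w hw, abs_zero]
      · rw [eh w hw]; exact (hgood w hw).2.1 p)
    hL
    (fun w p q => by
      by_cases hw : w ∈ N
      · simp [zh w hw, zF w hw]
      · simp only [eh w hw, eF w hw]; exact (hgood w hw).2.2 p q)
    hrad' hδ
  refine tendsto_of_tendsto_of_tendsto_of_le_of_le' tendsto_const_nhds key
    (Eventually.of_forall fun _ => zero_le) ((eventually_ne_atTop 0).mono fun n hn => ?_)
  refine measure_mono_ae (hWN.mono fun ω hω => ?_)
  rintro ⟨p, hp⟩
  change δ ≤ ⨆ p, _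
  simp only [eF _ (hω _), hmean]
  rw [hD.ciSup' (f := fun p => (1 / n : ℝ) * ∑ i : Fin n, (F (W i ω) p - ∫ v, F v p ∂P))
    (by fun_prop)]
  refine hp.trans (le_trans (le_of_eq ?_) (le_ciSup (bddAbove_range_of_abs_le
    (C := (1 / n : ℝ) * (n * (2 * C))) fun p => ?_) p))
  · have hn' : (n : ℝ) ≠ 0 := Nat.cast_ne_zero.2 hn
    rw [Finset.sum_sub_distrib, ← Fin.sum_univ_eq_sum_range (fun i => F (W i ω) p)]
    simp only [Finset.sum_const, Finset.card_univ, Fintype.card_fin, nsmul_eq_mul]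
    field_simp
  · rw [abs_mul, abs_of_nonneg (by positivity : (0 : ℝ) ≤ 1 / n)]
    exact mul_le_mul_of_nonneg_left (abs_sum_fin_le fun i =>
      (abs_sub _ _).trans (by linarith [(hgood _ (hω i)).1 p, hmC p])) (by positivity)

/-- The uniform law of large numbers, in (outer) probability: the empirical means of `F` converge
uniformly as soon as the increments of `F` are dominated by those of a class `h` whose
Rademacher complexity vanishes. -/
theorem tendsto_measure_exists_deviation {S : Type*} [TopologicalSpace S]
    [TopologicalSpace.SeparableSpace S] [Nonempty S]
    (hW : ∀ i, Measurable (W i)) (hlaw : ∀ i, μ.map (W i) = P) (hindep : iIndepFun W μ)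
    {F h : 𝒲 → S → ℝ} {C L : ℝ} (hF : ∀ p, Measurable fun w => F w p)
    (hh : ∀ p, Measurable fun w => h w p) (hFcont : ∀ w, Continuous (F w))
    (hhcont : ∀ w, Continuous (h w)) (hmcont : Continuous fun p => ∫ v, F v p ∂P) (hL : 0 ≤ L)
    (hFC : ∀ᵐ w ∂P, ∀ p, |F w p| ≤ C) (hhC : ∀ᵐ w ∂P, ∀ p, |h w p| ≤ C)
    (hFh : ∀ᵐ w ∂P, ∀ p q, |F w p - F w q| ≤ L * |h w p - h w q|)
    (hrad : Tendsto (rademacherComplexity μ W h) atTop (𝓝 0)) {δ : ℝ} (hδ : 0 < δ) :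
    Tendsto (fun n : ℕ => μ {ω | ∃ p, δ ≤
      |(1 / n : ℝ) * ∑ i ∈ Finset.range n, F (W i ω) p - ∫ v, F v p ∂P|}) atTop (𝓝 0) := by
  have hpos := tendsto_measure_exists_le_deviation hW hlaw hindep hF hh hFcont hhcont hmcont hL
    hFC hhC hFh hrad hδ
  have hneg := tendsto_measure_exists_le_deviation (F := fun w p => -F w p) hW hlaw hindep
    (fun p => (hF p).neg) hh (fun w => (hFcont w).neg) hhcont
    (by simp only [integral_neg]; exact hmcont.neg) hL (by simpa only [abs_neg] using hFC) hhC
    (hFh.mono fun w hw p q => by simpa only [neg_sub_neg, abs_sub_comm] using hw p q) hrad hδ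
  have hsum := hpos.add hneg
  rw [add_zero] at hsum
  refine tendsto_of_tendsto_of_tendsto_of_le_of_le tendsto_const_nhds hsum
    (fun _ => zero_le) fun n => (measure_mono ?_).trans (measure_union_le _ _)
  rintro ω ⟨p, hp⟩
  rcases le_abs.1 hp with h1 | h1
  · exact Or.inl ⟨p, h1⟩
  · refine Or.inr ⟨p, h1.trans (le_of_eq ?_)⟩
    rw [integral_neg, Finset.sum_neg_distrib]
    ring

end UniformLaw

/-! ### The payoff near an equilibrium -/

section Game

variable {Ω 𝒳 𝒵 Θ 𝒯 : Type*}

/-- A continuous moment function that vanishes, jointly in the critics, at no point of a compact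
set is bounded away from zero there by finitely many critics. -/
lemma exists_finset_lt_abs_of_isCompact [TopologicalSpace Θ] {ψ : 𝒯 → Θ → ℝ}
    (hψ : ∀ τ, Continuous (ψ τ)) {K : Set Θ} (hK : IsCompact K)
    (hne : ∀ θ ∈ K, ∃ τ, ψ τ θ ≠ 0) :
    ∃ (T : Finset 𝒯) (c : ℝ), 0 < c ∧ ∀ θ ∈ K, ∃ τ ∈ T, c < |ψ τ θ| := by
  classical
  refine hK.induction_on (p := fun s => ∃ (T : Finset 𝒯) (c : ℝ), 0 < c ∧
    ∀ θ ∈ s, ∃ τ ∈ T, c < |ψ τ θ|) ⟨∅, 1, one_pos, by simp⟩ ?_ ?_ ?_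
  · rintro s t hst ⟨T, c, hc, h⟩
    exact ⟨T, c, hc, fun θ hθ => h θ (hst hθ)⟩
  · rintro s t ⟨T₁, c₁, hc₁, h₁⟩ ⟨T₂, c₂, hc₂, h₂⟩
    refine ⟨T₁ ∪ T₂, min c₁ c₂, lt_min hc₁ hc₂, ?_⟩
    rintro θ (hθ | hθ)
    · obtain ⟨τ, hτ, hlt⟩ := h₁ θ hθ
      exact ⟨τ, Finset.mem_union_left _ hτ, (min_le_left _ _).trans_lt hlt⟩
    · obtain ⟨τ, hτ, hlt⟩ := h₂ θ hθ
      exact ⟨τ, Finset.mem_union_right _ hτ, (min_le_right _ _).trans_lt hlt⟩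
  · intro θ hθ
    obtain ⟨τ, hτ⟩ := hne θ hθ
    have hpos : 0 < |ψ τ θ| := abs_pos.2 hτ
    refine ⟨{θ' | |ψ τ θ| / 2 < |ψ τ θ'|}, mem_nhdsWithin_of_mem_nhds
      ((isOpen_lt continuous_const (hψ τ).abs).mem_nhds (half_lt_self hpos)),
      {τ}, |ψ τ θ| / 2, half_pos hpos, fun θ' h => ⟨τ, by simp, h⟩⟩

/-- The empirical moment `(1/n) ∑ f(Z_i; τ) (Y_i - g(X_i; θ))`, the linear part of the payoff. -/
noncomputable def empiricalMoment (X : ℕ → Ω → 𝒳) (Y : ℕ → Ω → ℝ) (Z : ℕ → Ω → 𝒵)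
    (g : 𝒳 → Θ → ℝ) (f : 𝒵 → 𝒯 → ℝ) (n : ℕ) (ω : Ω) (θ : Θ) (τ : 𝒯) : ℝ :=
  (1 / n : ℝ) * ∑ i ∈ Finset.range n, f (Z i ω) τ * (Y i ω - g (X i ω) θ)

/-- The empirical variance weight `(1/n) ∑ f(Z_i; τ)² (Y_i - g(X_i; θ'))²`, the quadratic part of
the payoff. -/
noncomputable def empiricalWeight (X : ℕ → Ω → 𝒳) (Y : ℕ → Ω → ℝ) (Z : ℕ → Ω → 𝒵)
    (g : 𝒳 → Θ → ℝ) (f : 𝒵 → 𝒯 → ℝ) (n : ℕ) (ω : Ω) (θ' : Θ) (τ : 𝒯) : ℝ :=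
  (1 / n : ℝ) * ∑ i ∈ Finset.range n, f (Z i ω) τ ^ 2 * (Y i ω - g (X i ω) θ') ^ 2

variable {X : ℕ → Ω → 𝒳} {Y : ℕ → Ω → ℝ} {Z : ℕ → Ω → 𝒵} {g : 𝒳 → Θ → ℝ} {f : 𝒵 → 𝒯 → ℝ}
  {n : ℕ} {ω : Ω} {B : ℝ}

lemma payoff_eq (θ' θ : Θ) (τ : 𝒯) :
    payoff X Y Z g f n ω θ' θ τ =
      empiricalMoment X Y Z g f n ω θ τ - 1 / 4 * empiricalWeight X Y Z g f n ω θ' τ := by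
  simp only [payoff, empiricalMoment, empiricalWeight, one_div, mul_inv]
  ring

lemma empiricalWeight_nonneg (θ' : Θ) (τ : 𝒯) : 0 ≤ empiricalWeight X Y Z g f n ω θ' τ :=
  mul_nonneg (by positivity) (Finset.sum_nonneg fun i _ => by positivity)

lemma inv_mul_sum_range_le {x : ℕ → ℝ} {C : ℝ} (hC : 0 ≤ C) (hx : ∀ i, x i ≤ C) :
    (1 / n : ℝ) * ∑ i ∈ Finset.range n, x i ≤ C := by
  rcases eq_or_ne n 0 with rfl | hn
  · simpa using hC
  · have hn' : (0 : ℝ) < n := by exact_mod_cast Nat.pos_of_ne_zero hn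
    rw [one_div, inv_mul_le_iff₀ hn']
    simpa using Finset.sum_le_card_nsmul (Finset.range n) x C fun i _ => hx i

lemma abs_residual_le {y a : ℝ} (hy : |y| ≤ B) (ha : |a| ≤ B) : |y - a| ≤ 2 * B :=
  (abs_sub _ _).trans (by linarith)

lemma empiricalWeight_le (hB : 0 ≤ B) (hY : ∀ i, |Y i ω| ≤ B) (hg : ∀ i θ, |g (X i ω) θ| ≤ B)
    (hf : ∀ i τ, |f (Z i ω) τ| ≤ B) (θ' : Θ) (τ : 𝒯) :
    empiricalWeight X Y Z g f n ω θ' τ ≤ B ^ 2 * (2 * B) ^ 2 := by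
  refine inv_mul_sum_range_le (by positivity) fun i => ?_
  rw [← sq_abs (f _ _), ← sq_abs (Y i ω - _)]
  gcongr
  · exact hf i τ
  · exact abs_residual_le (hY i) (hg i θ')

lemma abs_empiricalMoment_le (hB : 0 ≤ B) (hY : ∀ i, |Y i ω| ≤ B)
    (hg : ∀ i θ, |g (X i ω) θ| ≤ B) (hf : ∀ i τ, |f (Z i ω) τ| ≤ B) (θ : Θ) (τ : 𝒯) :
    |empiricalMoment X Y Z g f n ω θ τ| ≤ B * (2 * B) := by
  have h : ∀ i, |f (Z i ω) τ * (Y i ω - g (X i ω) θ)| ≤ B * (2 * B) := fun i => by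
    rw [abs_mul]
    exact mul_le_mul (hf i τ) (abs_residual_le (hY i) (hg i θ)) (abs_nonneg _) hB
  rw [empiricalMoment, abs_le']
  refine ⟨inv_mul_sum_range_le (by positivity) fun i => (le_abs_self _).trans (h i), ?_⟩
  rw [← mul_neg, ← Finset.sum_neg_distrib]
  exact inv_mul_sum_range_le (by positivity) fun i => (neg_le_abs _).trans (h i)

lemma abs_payoff_le (hB : 0 ≤ B) (hY : ∀ i, |Y i ω| ≤ B) (hg : ∀ i θ, |g (X i ω) θ| ≤ B)
    (hf : ∀ i τ, |f (Z i ω) τ| ≤ B) (θ' θ : Θ) (τ : 𝒯) :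
    |payoff X Y Z g f n ω θ' θ τ| ≤ B * (2 * B) + B ^ 2 * (2 * B) ^ 2 := by
  have h1 := abs_le.1 (abs_empiricalMoment_le (n := n) hB hY hg hf θ τ)
  have h2 := empiricalWeight_le (n := n) hB hY hg hf θ' τ
  have h3 := empiricalWeight_nonneg (X := X) (Y := Y) (Z := Z) (g := g) (f := f) (n := n) (ω := ω)
    θ' τ
  rw [payoff_eq, abs_le]
  constructor <;> linarith

/-- Along a critic scaled by `a`, the moment scales by `a` and the weight by `a ^ 2`. -/
lemma payoff_smul {τ τ' : 𝒯} {a : ℝ} (h : ∀ z, f z τ' = a * f z τ) (θ' θ : Θ) :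
    payoff X Y Z g f n ω θ' θ τ' = a * empiricalMoment X Y Z g f n ω θ τ -
      1 / 4 * (a ^ 2 * empiricalWeight X Y Z g f n ω θ' τ) := by
  simp only [payoff_eq, empiricalMoment, empiricalWeight, h, mul_pow, mul_assoc,
    ← Finset.mul_sum]
  ring

/-- The deterministic core of the argument: if at an approximate equilibrium `(θ₁, τ₁)` some critic
`τ` sees an empirical moment of size at least `c / 2`, then the approximation errors and the moment
of `τ₁` at `θ₀` cannot all be small. Shrinking `τ` by a factor `a` with `a * K ≤ c`, where `K` bounds
the quadratic term, makes that term at most half of the linear one. -/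
lemma quarter_mul_le_of_equilibrium (hB : 0 ≤ B) (hY : ∀ i, |Y i ω| ≤ B)
    (hg : ∀ i θ, |g (X i ω) θ| ≤ B) (hf : ∀ i τ, |f (Z i ω) τ| ≤ B)
    (hstar : AbsolutelyStarShaped (criticClass f)) {θ' θ₁ θ₀ : Θ} {τ τ₁ : 𝒯} {a c r s : ℝ}
    (ha : 0 < a) (ha1 : a ≤ 1) (hac : a * (B ^ 2 * (2 * B) ^ 2) ≤ c)
    (hsup : (⨆ τ, payoff X Y Z g f n ω θ' θ₁ τ) - r ≤ payoff X Y Z g f n ω θ' θ₁ τ₁)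
    (hinf : payoff X Y Z g f n ω θ' θ₁ τ₁ ≤ (⨅ θ, payoff X Y Z g f n ω θ' θ τ₁) + s)
    (hc : c / 2 ≤ |empiricalMoment X Y Z g f n ω θ₁ τ|) :
    a * c / 4 ≤ empiricalMoment X Y Z g f n ω θ₀ τ₁ + r + s := by
  set m := empiricalMoment X Y Z g f n ω θ₁ τ with hm
  obtain ⟨b, hb, hbm⟩ : ∃ b : ℝ, |b| = a ∧ b * m = a * |m| := by
    rcases abs_choice m with h | h
    · exact ⟨a, abs_of_pos ha, by rw [h]⟩
    · exact ⟨-a, by rw [abs_neg, abs_of_pos ha], by rw [h]; ring⟩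
  obtain ⟨τ', hτ'⟩ := hstar _ ⟨τ, rfl⟩ b (hb.le.trans ha1)
  have hbd := abs_payoff_le (n := n) hB hY hg hf
  have h1 : payoff X Y Z g f n ω θ' θ₁ τ' ≤ ⨆ τ, payoff X Y Z g f n ω θ' θ₁ τ :=
    le_ciSup (bddAbove_range_of_abs_le fun τ => hbd θ' θ₁ τ) τ'
  have h2 : (⨅ θ, payoff X Y Z g f n ω θ' θ τ₁) ≤ payoff X Y Z g f n ω θ' θ₀ τ₁ :=
    ciInf_le ⟨_, by rintro _ ⟨θ, rfl⟩; exact (abs_le.1 (hbd θ' θ τ₁)).1⟩ θ₀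
  have h3 := empiricalWeight_nonneg (X := X) (Y := Y) (Z := Z) (g := g) (f := f) (n := n) (ω := ω)
    θ' τ₁
  rw [payoff_eq θ' θ₀] at h2
  rw [payoff_smul (fun z => congrFun hτ' z), ← hm, hbm, ← sq_abs b, hb] at h1
  have h4 : a ^ 2 * empiricalWeight X Y Z g f n ω θ' τ ≤ a * c := by
    rw [sq, mul_assoc]
    refine mul_le_mul_of_nonneg_left (le_trans ?_ hac) ha.le
    exact mul_le_mul_of_nonneg_left (empiricalWeight_le hB hY hg hf θ' τ) ha.le
  have h5 := mul_le_mul_of_nonneg_left hc ha.le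
  linarith

end Game

end DeepGMM

/-! ### Consistency -/

open DeepGMM in
theorem theorem1
    {Ω 𝒳 𝒵 Θ 𝒯 : Type*}
    [MeasurableSpace Ω] (μ : Measure Ω) [IsProbabilityMeasure μ]
    [MeasurableSpace 𝒳] [MeasurableSpace 𝒵]
    [MetricSpace Θ] [CompactSpace Θ]
    [TopologicalSpace 𝒯] [TopologicalSpace.SeparableSpace 𝒯]
    -- the i.i.d. sample, with common law `P`
    (P : Measure (𝒳 × ℝ × 𝒵))
    (X : ℕ → Ω → 𝒳) (Y : ℕ → Ω → ℝ) (Z : ℕ → Ω → 𝒵)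
    (hX : ∀ i, Measurable (X i)) (hY : ∀ i, Measurable (Y i)) (hZ : ∀ i, Measurable (Z i))
    (hlaw : ∀ i, μ.map (fun ω => (X i ω, Y i ω, Z i ω)) = P)
    (hindep : iIndepFun (fun i ω => (X i ω, Y i ω, Z i ω)) μ)
    -- the two parametrized classes of functions
    (g : 𝒳 → Θ → ℝ) (f : 𝒵 → 𝒯 → ℝ)
    (hg : ∀ θ, Measurable fun x => g x θ) (hf : ∀ τ, Measurable fun z => f z τ)
    -- the assumptions
    (θ₀ : Θ)
    (hident : DeepGMM.Identified P g f θ₀)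
    (hradf : Tendsto (DeepGMM.rademacherComplexity μ Z f) atTop (𝓝 0))
    (hradg : Tendsto (DeepGMM.rademacherComplexity μ X g) atTop (𝓝 0))
    (hstar : DeepGMM.AbsolutelyStarShaped (DeepGMM.criticClass f))
    (hcontg : ∀ x, Continuous (g x)) (hcontf : ∀ z, Continuous (f z))
    (hbdd : DeepGMM.BoundedModel P g f)
    -- the weighting parameters, with a limit in probability
    (θtilde : ℕ → Ω → Θ) (θlim : Ω → Θ)
    (htilde : TendstoInMeasure μ θtilde atTop θlim)
    -- the approximate equilibrium
    (θhat : ℕ → Ω → Θ) (τhat : ℕ → Ω → 𝒯)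
    (heq : DeepGMM.IsApproxEquilibrium μ X Y Z g f θtilde θhat τhat) :
    TendstoInMeasure μ θhat atTop (fun _ => θ₀) := by
  have : Nonempty Ω := μ.nonempty_of_neZero
  have : Nonempty 𝒯 := ⟨τhat 0 (Classical.arbitrary Ω)⟩
  have : Nonempty Θ := ⟨θ₀⟩
  set W : ℕ → Ω → 𝒳 × ℝ × 𝒵 := fun i ω => (X i ω, Y i ω, Z i ω) with hWdef
  have hW : ∀ i, Measurable (W i) := fun i => (hX i).prodMk ((hY i).prodMk (hZ i))
  have hP : IsProbabilityMeasure P := hlaw 0 ▸ Measure.isProbabilityMeasure_map (hW 0).aemeasurable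
  obtain ⟨B, hB⟩ := hbdd
  have hB0 : 0 ≤ B := by
    obtain ⟨w, hw⟩ := hB.exists
    exact (abs_nonneg _).trans hw.1
  have hsample : ∀ᵐ ω ∂μ, ∀ i, |Y i ω| ≤ B ∧ (∀ θ, |g (X i ω) θ| ≤ B) ∧
      ∀ τ, |f (Z i ω) τ| ≤ B := ae_all_iff.2 fun i =>
    ae_of_ae_map (f := W i) (hW i).aemeasurable (by rwa [hlaw i])
  have hFmeas : ∀ θ τ, Measurable fun w : 𝒳 × ℝ × 𝒵 => f w.2.2 τ * (w.2.1 - g w.1 θ) :=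
    fun θ τ => ((hf τ).comp measurable_snd.snd).mul
      (measurable_snd.fst.sub ((hg θ).comp measurable_fst))
  have hFC : ∀ᵐ w ∂P, ∀ θ τ, |f w.2.2 τ * (w.2.1 - g w.1 θ)| ≤ B * (2 * B) + B :=
    hB.mono fun w hw θ τ => by
      rw [abs_mul]
      have := mul_le_mul (hw.2.2 τ) (abs_residual_le hw.1 (hw.2.1 θ)) (abs_nonneg _) hB0
      linarith
  have hBC : B ≤ B * (2 * B) + B := le_add_of_nonneg_left (by positivity)
  -- Since `𝒯` need not be first countable, dominated convergence does not give continuity of the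
  -- mean in `τ`; at `θ₀` the mean is constant.
  have hzero : ∀ τ, ∫ w, f w.2.2 τ * (w.2.1 - g w.1 θ₀) ∂P = 0 := fun τ =>
    hident.1 _ ⟨τ, rfl⟩
  have hψcont : ∀ τ, Continuous fun θ => ∫ w, f w.2.2 τ * (w.2.1 - g w.1 θ) ∂P := fun τ =>
    continuous_of_dominated (bound := fun _ => B * (2 * B) + B)
      (fun θ => (hFmeas θ τ).aestronglyMeasurable)
      (fun θ => hFC.mono fun w hw => hw θ τ) (integrable_const _)
      (ae_of_all _ fun w => continuous_const.mul (continuous_const.sub (hcontg w.1)))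
  have hcritics : ∀ {δ : ℝ}, 0 < δ → Tendsto (fun n : ℕ => μ {ω | ∃ τ, δ ≤
      |empiricalMoment X Y Z g f n ω θ₀ τ|}) atTop (𝓝 0) := fun {δ} hδ => by
    have := tendsto_measure_exists_deviation (L := 2 * B) hW hlaw hindep
      (F := fun w τ => f w.2.2 τ * (w.2.1 - g w.1 θ₀)) (h := fun w τ => f w.2.2 τ) (hFmeas θ₀)
      (fun τ => (hf τ).comp measurable_snd.snd) (fun w => (hcontf w.2.2).mul continuous_const)
      (fun w => hcontf w.2.2) (by simp only [hzero]; exact continuous_const) (by positivity)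
      (hFC.mono fun w hw => hw θ₀) (hB.mono fun w hw τ => (hw.2.2 τ).trans hBC)
      (hB.mono fun w hw τ τ' => by
        rw [← sub_mul, abs_mul, mul_comm]
        exact mul_le_mul_of_nonneg_right (abs_residual_le hw.1 (hw.2.1 θ₀)) (abs_nonneg _))
      hradf hδ
    simp only [hzero, sub_zero] at this
    exact this
  have hmodels : ∀ τ {δ : ℝ}, 0 < δ → Tendsto (fun n : ℕ => μ {ω | ∃ θ, δ ≤
      |empiricalMoment X Y Z g f n ω θ τ - ∫ w, f w.2.2 τ * (w.2.1 - g w.1 θ) ∂P|})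
      atTop (𝓝 0) := fun τ {δ} hδ =>
    tendsto_measure_exists_deviation (L := B) hW hlaw hindep
      (F := fun w θ => f w.2.2 τ * (w.2.1 - g w.1 θ)) (h := fun w θ => g w.1 θ)
      (fun θ => hFmeas θ τ) (fun θ => (hg θ).comp measurable_fst)
      (fun w => continuous_const.mul (continuous_const.sub (hcontg w.1)))
      (fun w => hcontg w.1) (hψcont τ) hB0
      (hFC.mono fun w hw θ => hw θ τ) (hB.mono fun w hw θ => (hw.2.1 θ).trans hBC)
      (hB.mono fun w hw θ θ' => by
        rw [← mul_sub, abs_mul, sub_sub_sub_cancel_left, abs_sub_comm]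
        exact mul_le_mul_of_nonneg_right (hw.2.2 τ) (abs_nonneg _))
      hradg hδ
  obtain ⟨r, s, hr, hs, hrs⟩ := heq
  rw [tendstoInMeasure_iff_dist]
  intro ε hε
  obtain ⟨T, c, hc, hT⟩ := exists_finset_lt_abs_of_isCompact hψcont
    (K := {θ | ε ≤ dist θ θ₀})
    (isClosed_le continuous_const (continuous_id.dist continuous_const)).isCompact
    (fun θ hθ => by
      by_contra! hall
      have : θ = θ₀ := hident.2 θ (by rintro _ ⟨τ, rfl⟩; exact hall τ)
      rw [this, Set.mem_ofPred_eq, dist_self] at hθ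
      exact hε.not_ge hθ)
  set κ := B ^ 2 * (2 * B) ^ 2 with hκ
  have hκ0 : 0 ≤ κ := by positivity
  -- The scale satisfies `a ≤ 1` and `a * κ ≤ c`.
  set a := c / (c + κ) with ha
  have ha0 : 0 < a := by positivity
  have ha1 : a ≤ 1 := div_le_one_of_le₀ (by linarith) (by positivity)
  have haκ : a * κ ≤ c := by
    rw [ha, div_mul_eq_mul_div, div_le_iff₀ (by positivity)]
    nlinarith
  -- Three errors below `η` stay below the gain `a * c / 4`.
  set η := a * c / 12 with hη
  have hη0 : 0 < η := by positivity
  have hbad := (((hcritics hη0).add (tendsto_finsetSum T fun τ _ =>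
    hmodels τ (half_pos hc))).add (tendstoInMeasure_iff_dist.1 hr η hη0)).add
      (tendstoInMeasure_iff_dist.1 hs η hη0)
  simp only [Finset.sum_const_zero, add_zero] at hbad
  refine tendsto_of_tendsto_of_tendsto_of_le_of_le tendsto_const_nhds hbad
    (fun _ => zero_le) fun n => ?_
  refine le_trans (measure_mono_ae (t := (({ω | ∃ τ, η ≤ |empiricalMoment X Y Z g f n ω θ₀ τ|} ∪
    ⋃ τ ∈ T, {ω | ∃ θ, c / 2 ≤ |empiricalMoment X Y Z g f n ω θ τ -
      ∫ w, f w.2.2 τ * (w.2.1 - g w.1 θ) ∂P|}) ∪ {ω | η ≤ dist (r n ω) 0}) ∪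
        {ω | η ≤ dist (s n ω) 0}) ?_) ?_
  · filter_upwards [hsample, hrs n] with ω hω hrsω hdist
    change ε ≤ dist (θhat n ω) θ₀ at hdist
    change ω ∈ (_ : Set Ω)
    by_contra hgood
    have hr' : r n ω < η := by
      by_contra! h
      exact hgood (Or.inl (Or.inr (h.trans ((le_abs_self _).trans_eq (Real.dist_0_eq_abs _).symm))))
    have hs' : s n ω < η := by
      by_contra! h
      exact hgood (Or.inr (h.trans ((le_abs_self _).trans_eq (Real.dist_0_eq_abs _).symm)))
    have hcrit : |empiricalMoment X Y Z g f n ω θ₀ (τhat n ω)| < η := by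
      by_contra! h
      exact hgood (Or.inl (Or.inl (Or.inl ⟨_, h⟩)))
    obtain ⟨τ, hτ, hlt⟩ := hT _ hdist
    have hmod : |empiricalMoment X Y Z g f n ω (θhat n ω) τ -
        ∫ w, f w.2.2 τ * (w.2.1 - g w.1 (θhat n ω)) ∂P| < c / 2 := by
      by_contra! h
      exact hgood (Or.inl (Or.inl (Or.inr (Set.mem_biUnion hτ ⟨_, h⟩))))
    have hlarge : c / 2 ≤ |empiricalMoment X Y Z g f n ω (θhat n ω) τ| := by
      have := abs_sub_abs_le_abs_sub (∫ w, f w.2.2 τ * (w.2.1 - g w.1 (θhat n ω)) ∂P)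
        (empiricalMoment X Y Z g f n ω (θhat n ω) τ)
      rw [abs_sub_comm] at this
      linarith
    have key := quarter_mul_le_of_equilibrium (θ₀ := θ₀) hB0 (fun i => (hω i).1)
      (fun i => (hω i).2.1) (fun i => (hω i).2.2) hstar ha0 ha1 haκ hrsω.1 hrsω.2 hlarge
    linarith [le_abs_self (empiricalMoment X Y Z g f n ω θ₀ (τhat n ω))]
  · refine (measure_union_le _ _).trans (add_le_add ?_ le_rfl)
    refine (measure_union_le _ _).trans (add_le_add ?_ le_rfl)
    exact (measure_union_le _ _).trans (add_le_add le_rfl (measure_biUnion_finset_le _ _))
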